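/- Let $D$ be an integral domain which is not a field, with quotient field $K$. A semistar operation on $D$ is a map $E \mapsto E^\star$ on the set of nonzero $D$-submodules of $K$ such that, for all nonzero $x \in K$ and all nonzero $D$-submodules $E, F$ of $K$: $(xE)^\star = xE^\star$; $E \subseteq F$ implies $E^\star \subseteq F^\star$; $E \subseteq E^\star$ and $(E^\star)^\star = E^\star$. Let $\star$ be a semistar operation on $D$, and let $\star_f$ be the semistar operation $E^{\star_f} = \bigcup\{F^\star : F \subseteq E \text{ a nonzero finitely generated } D\text{-submodule}\}$. A quasi-$\star_f$-maximal ideal of $D$ is an ideal that is maximal among the proper nonzero ideals $I$ of $D$ with $I = I^{\star_f} \cap D$; such an ideal is prime. Call $D$ a $\star$-almost Dedekind domain if $D_M$ is a rank-one discrete valuation domain (DVR) for every quasi-$\star_f$-maximal ideal $M$ of $D$. Call an integral domain $R$ an almost Dedekind domain if $R_M$ is a DVR for every nonzero maximal ideal $M$ of $R$ (so a field is, by convention, an almost Dedekind domain). For $h \in D[X]$ let $c(h)$ be its content, the ideal of $D$ generated by the coefficients of $h$. Let $N(\star) = \{h \in D[X] : h \neq 0,\ c(h)^\star = D^\star\}$,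 which is a multiplicative set; let $\mathrm{Na}(D,\star) = D[X]_{N(\star)} \subseteq K(X)$ be the Nagata ring, and let $$\mathrm{Kr}(D,\star) = \{0\} \cup \{ f/g : f, g \in D[X]\setminus\{0\},\ (c(f)c(h))^\star \subseteq (c(g)c(h))^\star \text{ for some } h \in D[X]\setminus\{0\}\} \subseteq K(X)$$ be the Kronecker function ring of $D$ with respect to $\star$. Theorem. The following are equivalent: 1. $D$ is a $\star$-almost Dedekind domain. 2. $\mathrm{Na}(D,\star)$ is an almost Dedekind domain. 3. $\mathrm{Na}(D,\star)$ is a field, or it is a one-dimensional Prüfer domain (every nonzero finitely generated ideal is invertible) with no idempotent maximal ideal. 4. $\mathrm{Na}(D,\star) = \mathrm{Kr}(D,\star)$, and this ring is an almost Dedekind domain and a Bézout domain. -/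

import Mathlib

open scoped Pointwise Polynomial

/-- A semistar operation on an integral domain `D` with quotient field `K`.

It is a map `E ↦ E^⋆` on the nonzero `D`-submodules of `K` with
`(xE)^⋆ = x E^⋆` for `x ≠ 0`, monotone, extensive and idempotent.  Here it is carried as a map on all
`D`-submodules of `K`, normalized by `0^⋆ = 0`; as `E ⊆ E^⋆`, it maps nonzero
submodules to nonzero submodules, the axioms are automatic at the zero submodule, and each
semistar operation has exactly one such extension. -/
structure SemistarOp (D K : Type*) [CommRing D] [Field K] [Algebra D K] where
  /-- The map `E ↦ E^⋆`. -/
  star : Submodule D K → Submodule D K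
  star_bot : star ⊥ = ⊥
  star_smul : ∀ (x : K), x ≠ 0 → ∀ E : Submodule D K, star (x • E) = x • star E
  star_mono : ∀ E F : Submodule D K, E ≤ F → star E ≤ star F
  le_star : ∀ E : Submodule D K, E ≤ star E
  star_star : ∀ E : Submodule D K, star (star E) = star E

namespace SemistarOp

section

variable {D K : Type*} [CommRing D] [Field K] [Algebra D K]

/-- The union of the `F^⋆` over the finitely generated submodules `F ⊆ E`. -/
def finSub (s : SemistarOp D K) (E : Submodule D K) : Submodule D K where
  carrier := {x | ∃ F : Submodule D K, F.FG ∧ F ≤ E ∧ x ∈ s.star F}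
  zero_mem' := ⟨⊥, Submodule.fg_bot, bot_le, Submodule.zero_mem _⟩
  add_mem' := by
    rintro x y ⟨F, hF, hFE, hx⟩ ⟨G, hG, hGE, hy⟩
    exact ⟨F ⊔ G, hF.sup hG, sup_le hFE hGE,
      Submodule.add_mem _ (s.star_mono _ _ le_sup_left hx) (s.star_mono _ _ le_sup_right hy)⟩
  smul_mem' := by
    rintro c x ⟨F, hF, hFE, hx⟩
    exact ⟨F, hF, hFE, Submodule.smul_mem _ c hx⟩

theorem mem_finSub {s : SemistarOp D K} {E : Submodule D K} {x : K} :
    x ∈ s.finSub E ↔ ∃ F : Submodule D K, F.FG ∧ F ≤ E ∧ x ∈ s.star F := Iff.rfl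

theorem finSub_mono (s : SemistarOp D K) {E F : Submodule D K} (h : E ≤ F) :
    s.finSub E ≤ s.finSub F := by
  rintro x ⟨G, hG, hGE, hx⟩
  exact ⟨G, hG, hGE.trans h, hx⟩

theorem le_finSub (s : SemistarOp D K) (E : Submodule D K) : E ≤ s.finSub E := by
  intro x hx
  exact ⟨Submodule.span D {x}, Submodule.fg_span_singleton x,
    (Submodule.span_singleton_le_iff_mem _ _).2 hx,
    s.le_star _ (Submodule.mem_span_singleton_self x)⟩

theorem exists_fg_of_le_finSub (s : SemistarOp D K) {E F : Submodule D K} (hF : F.FG)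
    (h : F ≤ s.finSub E) : ∃ G : Submodule D K, G.FG ∧ G ≤ E ∧ F ≤ s.star G := by
  induction F, hF using Submodule.fg_induction with
  | singleton x =>
    obtain ⟨G, hG, hGE, hx⟩ := h (Submodule.mem_span_singleton_self x)
    exact ⟨G, hG, hGE, (Submodule.span_singleton_le_iff_mem _ _).2 hx⟩
  | sup F₁ F₂ _ _ ih₁ ih₂ =>
    obtain ⟨G₁, h₁, h₁E, h₁F⟩ := ih₁ (le_sup_left.trans h)
    obtain ⟨G₂, h₂, h₂E, h₂F⟩ := ih₂ (le_sup_right.trans h)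
    exact ⟨G₁ ⊔ G₂, h₁.sup h₂, sup_le h₁E h₂E,
      sup_le (h₁F.trans (s.star_mono _ _ le_sup_left))
        (h₂F.trans (s.star_mono _ _ le_sup_right))⟩

theorem smul_finSub_le (s : SemistarOp D K) {x : K} (hx : x ≠ 0) (E : Submodule D K) :
    x • s.finSub E ≤ s.finSub (x • E) := by
  intro y hy
  obtain ⟨z, hz, rfl⟩ := Submodule.mem_smul_pointwise_iff_exists _ _ _ |>.1 hy
  obtain ⟨F, hF, hFE, hzF⟩ := mem_finSub.1 hz
  refine ⟨x • F, hF.map _, Submodule.map_mono hFE, ?_⟩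
  rw [s.star_smul x hx]
  exact Submodule.smul_mem_pointwise_smul _ _ _ hzF

/-- The semistar operation of finite type `⋆_f` associated to `⋆`:
`E^{⋆_f}` is the union of the `F^⋆`, for `F ⊆ E` finitely generated. -/
def finType (s : SemistarOp D K) : SemistarOp D K where
  star := s.finSub
  star_bot := by
    refine le_antisymm ?_ bot_le
    rintro x ⟨F, -, hF, hx⟩
    rwa [le_bot_iff.1 hF, s.star_bot] at hx
  star_smul := by
    intro x hx E
    refine le_antisymm ?_ (s.smul_finSub_le hx E)
    have h := s.smul_finSub_le (inv_ne_zero hx) (x • E)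
    rw [smul_smul, inv_mul_cancel₀ hx, one_smul] at h
    have h' : x • (x⁻¹ • s.finSub (x • E)) ≤ x • s.finSub E := Submodule.map_mono h
    rwa [smul_smul, mul_inv_cancel₀ hx, one_smul] at h'
  star_mono := fun _ _ h => s.finSub_mono h
  le_star := s.le_finSub
  star_star := by
    intro E
    refine le_antisymm ?_ (s.le_finSub _)
    rintro x ⟨F, hF, hFE, hx⟩
    obtain ⟨G, hG, hGE, hFG⟩ := s.exists_fg_of_le_finSub hF hFE
    refine ⟨G, hG, hGE, ?_⟩
    have := s.star_mono _ _ hFG hx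
    rwa [s.star_star] at this

/-- The `D`-submodule of `K` underlying an ideal of `D`. -/
abbrev toSub (K : Type*) [Field K] [Algebra D K] (I : Ideal D) : Submodule D K :=
  IsLocalization.coeSubmodule K I

/-- The ideal `I^⋆ ∩ D` of `D`. -/
def starInter (s : SemistarOp D K) (I : Ideal D) : Ideal D :=
  (s.star (toSub K I)).comap (Algebra.linearMap D K)

theorem mem_starInter {s : SemistarOp D K} {I : Ideal D} {a : D} :
    a ∈ s.starInter I ↔ algebraMap D K a ∈ s.star (toSub K I) := Iff.rfl

theorem le_starInter (s : SemistarOp D K) (I : Ideal D) : I ≤ s.starInter I :=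
  fun a ha => s.le_star _ ((IsLocalization.mem_coeSubmodule K I).2 ⟨a, ha, rfl⟩)

/-- A quasi-`⋆`-ideal of `D`: a nonzero ideal `I` of `D` with `I = I^⋆ ∩ D`. -/
def IsQuasiIdeal (s : SemistarOp D K) (I : Ideal D) : Prop :=
  I ≠ ⊥ ∧ I = s.starInter I

/-- A quasi-`⋆`-maximal ideal of `D`: a proper ideal, maximal among the proper
quasi-`⋆`-ideals of `D`. -/
def IsQuasiMaximal (s : SemistarOp D K) (M : Ideal D) : Prop :=
  Maximal (fun I : Ideal D => s.IsQuasiIdeal I ∧ I ≠ ⊤) M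

theorem isQuasiIdeal_starInter (s : SemistarOp D K) {I : Ideal D} (hI : I ≠ ⊥) :
    s.IsQuasiIdeal (s.starInter I) := by
  refine ⟨fun h => hI (le_bot_iff.1 (h ▸ s.le_starInter I)),
    le_antisymm (s.le_starInter _) fun a ha => ?_⟩
  have h : toSub K (s.starInter I) ≤ s.star (toSub K I) := by
    intro x hx
    obtain ⟨y, hy, rfl⟩ := (IsLocalization.mem_coeSubmodule K _).1 hx
    exact hy
  have := s.star_mono _ _ h ha
  rwa [s.star_star] at this

theorem smul_star_le (s : SemistarOp D K) {E F : Submodule D K} (x : K)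
    (h : x • E ≤ F) : x • s.star E ≤ s.star F := by
  by_cases hx : x = 0
  · subst hx
    rintro y hy
    obtain ⟨z, -, rfl⟩ := Submodule.mem_smul_pointwise_iff_exists _ _ _ |>.1 hy
    simp
  · rw [← s.star_smul x hx]
    exact s.star_mono _ _ h

/-- Each quasi-`⋆`-maximal ideal is prime. -/
theorem IsQuasiMaximal.isPrime {s : SemistarOp D K} {M : Ideal D} (hM : s.IsQuasiMaximal M) :
    M.IsPrime := by
  obtain ⟨⟨⟨hM0, hMq⟩, hMtop⟩, hmax⟩ := hM
  refine ⟨hMtop, fun {a b} hab => or_iff_not_imp_left.2 fun ha => ?_⟩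
  set J := M ⊔ Ideal.span {a} with hJ
  have hJ0 : J ≠ ⊥ := fun h => hM0 (le_bot_iff.1 (h ▸ le_sup_left))
  have htop : s.starInter J = ⊤ := by
    by_contra hne
    have hle := hmax ⟨s.isQuasiIdeal_starInter hJ0, hne⟩ (le_sup_left.trans (s.le_starInter J))
    exact ha (hle (s.le_starInter J
      ((le_sup_right : _ ≤ J) (Ideal.mem_span_singleton_self a))))
  have h1 : algebraMap D K 1 ∈ s.star (toSub K J) :=
    mem_starInter.1 (htop ▸ Submodule.mem_top)
  have hb : algebraMap D K b • toSub K J ≤ toSub K M := by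
    intro y hy
    obtain ⟨z, hz, rfl⟩ := Submodule.mem_smul_pointwise_iff_exists _ _ _ |>.1 hy
    obtain ⟨c, hc, rfl⟩ := (IsLocalization.mem_coeSubmodule K _).1 hz
    refine (IsLocalization.mem_coeSubmodule K _).2 ⟨b * c, ?_, by simp⟩
    obtain ⟨m, hm, d, hd, rfl⟩ := Submodule.mem_sup.1 hc
    obtain ⟨e, rfl⟩ := Ideal.mem_span_singleton'.1 hd
    have : b * (m + e * a) = b * m + e * (a * b) := by ring
    rw [this]
    exact M.add_mem (M.mul_mem_left _ hm) (M.mul_mem_left _ hab)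
  rw [hMq, mem_starInter]
  have := s.smul_star_le _ hb (Submodule.smul_mem_pointwise_smul _ (algebraMap D K b) _ h1)
  simpa using this

/-- `D` is a `⋆`-almost Dedekind domain: the localization `D_M` is a (rank-one) discrete valuation
domain for each quasi-`⋆_f`-maximal ideal `M` of `D`. -/
def IsAlmostDedekind [IsDomain D] (s : SemistarOp D K) : Prop :=
  ∀ (M : Ideal D) (hM : s.finType.IsQuasiMaximal M),
    haveI := hM.isPrime
    IsDiscreteValuationRing (Localization.AtPrime M)

/-- If `E^⋆ = D^⋆`, then `F ⊆ (EF)^⋆`. -/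
theorem le_star_mul (s : SemistarOp D K) {E : Submodule D K} (hE : s.star E = s.star 1)
    (F : Submodule D K) : F ≤ s.star (E * F) := by
  intro x hx
  have h : x • E ≤ E * F := by
    intro y hy
    obtain ⟨z, hz, rfl⟩ := Submodule.mem_smul_pointwise_iff_exists _ _ _ |>.1 hy
    have hy' : x • z = z * x := by rw [smul_eq_mul, mul_comm]
    rw [hy']
    exact Submodule.mul_mem_mul hz hx
  have h1 : (1 : K) ∈ s.star E := hE ▸ s.le_star _ (Submodule.one_le.1 le_rfl)
  simpa using s.smul_star_le x h (Submodule.smul_mem_pointwise_smul _ x _ h1)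

theorem star_toSub_le (s : SemistarOp D K) (I : Ideal D) : s.star (toSub K I) ≤ s.star 1 := by
  refine s.star_mono _ _ ?_
  rw [← IsLocalization.coeSubmodule_top K]
  exact IsLocalization.coeSubmodule_mono K le_top

theorem star_mul_eq (s : SemistarOp D K) {I J : Ideal D}
    (hI : s.star (toSub K I) = s.star 1) (hJ : s.star (toSub K J) = s.star 1) :
    s.star (toSub K (I * J)) = s.star 1 := by
  refine le_antisymm (s.star_toSub_le _) ?_
  rw [← hJ, show toSub K (I * J) = toSub K I * toSub K J from
    IsLocalization.coeSubmodule_mul K I J]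
  have := s.star_mono _ _ (s.le_star_mul hI (toSub K J))
  rwa [s.star_star] at this

theorem star_pow_eq (s : SemistarOp D K) {I : Ideal D}
    (hI : s.star (toSub K I) = s.star 1) (n : ℕ) :
    s.star (toSub K (I ^ n)) = s.star 1 := by
  induction n with
  | zero => rw [pow_zero, Ideal.one_eq_top, toSub, IsLocalization.coeSubmodule_top]
  | succ n ih => rw [pow_succ]; exact s.star_mul_eq ih hI

/-- The multiplicative set `N(⋆)` of the nonzero polynomials `h ∈ D[X]` with
`c(h)^⋆ = D^⋆`, where `c(h)` is the content ideal. -/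
def nagataSet [IsDomain D] (s : SemistarOp D K) : Submonoid D[X] where
  carrier := {h | h ≠ 0 ∧ s.star (toSub K h.contentIdeal) = s.star 1}
  one_mem' := ⟨one_ne_zero, by
    rw [Polynomial.contentIdeal_one, toSub, IsLocalization.coeSubmodule_top]⟩
  mul_mem' := by
    rintro f g ⟨hf, hf1⟩ ⟨hg, hg1⟩
    refine ⟨mul_ne_zero hf hg, le_antisymm (s.star_toSub_le _) ?_⟩
    obtain ⟨n, hn⟩ := Ideal.exists_pow_le_of_le_radical_of_fg
      (Polynomial.mul_contentIdeal_le_radical_contentIdeal_mul (p := f) (q := g))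
      (Submodule.FG.mul f.contentIdeal_FG g.contentIdeal_FG)
    rw [← s.star_pow_eq (s.star_mul_eq hf1 hg1) n]
    exact s.star_mono _ _ (IsLocalization.coeSubmodule_mono K hn)

/-- The canonical map `D[X] → K(X)`. -/
noncomputable def polyToRat (D K : Type*) [CommRing D] [Field K] [Algebra D K] :
    D[X] →+* RatFunc K :=
  (algebraMap K[X] (RatFunc K)).comp (Polynomial.mapRingHom (algebraMap D K))

theorem polyToRat_ne_zero [FaithfulSMul D K] {g : D[X]} (hg : g ≠ 0) :
    polyToRat D K g ≠ 0 := by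
  intro h
  refine hg (Polynomial.map_injective _ (FaithfulSMul.algebraMap_injective D K) ?_)
  rw [Polynomial.map_zero]
  exact RatFunc.algebraMap_injective K (by simpa [polyToRat] using h)

/-- The Nagata ring `Na(D,⋆) = D[X]_{N(⋆)}`, as the subring
`{f/g | f ∈ D[X], g ∈ N(⋆)}` of the field `K(X)`. -/
noncomputable def nagata [IsDomain D] [FaithfulSMul D K] (s : SemistarOp D K) :
    Subring (RatFunc K) where
  carrier := {r | ∃ f g : D[X], g ∈ s.nagataSet ∧ r = polyToRat D K f / polyToRat D K g}
  zero_mem' := ⟨0, 1, s.nagataSet.one_mem, by simp⟩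
  one_mem' := ⟨1, 1, s.nagataSet.one_mem, by simp⟩
  add_mem' := by
    rintro _ _ ⟨f, g, hg, rfl⟩ ⟨f', g', hg', rfl⟩
    refine ⟨f * g' + g * f', g * g', s.nagataSet.mul_mem hg hg', ?_⟩
    rw [div_add_div _ _ (polyToRat_ne_zero hg.1) (polyToRat_ne_zero hg'.1)]
    simp
  neg_mem' := by
    rintro _ ⟨f, g, hg, rfl⟩
    exact ⟨-f, g, hg, by rw [map_neg, neg_div]⟩
  mul_mem' := by
    rintro _ _ ⟨f, g, hg, rfl⟩ ⟨f', g', hg', rfl⟩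
    exact ⟨f * f', g * g', s.nagataSet.mul_mem hg hg', by rw [div_mul_div_comm]; simp⟩

/-- The Kronecker function ring `Kr(D,⋆)`, as a subset of the field `K(X)`: it consists of `0` and of
the fractions `f/g` with `f, g ∈ D[X]` nonzero for which there is a nonzero `h ∈ D[X]` with
`(c(f)c(h))^⋆ ⊆ (c(g)c(h))^⋆`. -/
def kronecker (s : SemistarOp D K) : Set (RatFunc K) :=
  {r | ∃ f g : D[X], f ≠ 0 ∧ g ≠ 0 ∧ r = polyToRat D K f / polyToRat D K g ∧
    ∃ h : D[X], h ≠ 0 ∧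
      s.star (toSub K (f.contentIdeal * h.contentIdeal)) ≤
        s.star (toSub K (g.contentIdeal * h.contentIdeal))} ∪ {0}

end

end SemistarOp

/-- An almost Dedekind domain: `R_M` is a (rank-one) discrete valuation domain for
each nonzero maximal ideal `M` of `R`.  A field is, by convention, an almost Dedekind domain. -/
def IsAlmostDedekindDomain (R : Type*) [CommRing R] [IsDomain R] : Prop :=
  ∀ (M : Ideal R) [M.IsMaximal], M ≠ ⊥ → IsDiscreteValuationRing (Localization.AtPrime M)

/-- A Prüfer domain: each nonzero finitely generated ideal is invertible. -/
def IsPruferDomain (R : Type*) [CommRing R] [IsDomain R] : Prop :=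
  ∀ I : Ideal R, I ≠ ⊥ → I.FG →
    IsUnit (I : FractionalIdeal (nonZeroDivisors R) (FractionRing R))

/-!
The Nagata ring is the localization of `D[X]` at `N(⋆)`, and its nonzero maximal ideals are the
extensions of the ideals `M[X]`, for `M` quasi-`⋆_f`-maximal
(`SemistarOp.exists_isQuasiMaximal_comap_eq`, `SemistarOp.IsQuasiMaximal.exists_isMaximal_nagata`).
This rests on `SemistarOp.exists_mem_nagataSet`: an ideal of `D[X]` contained in no `M[X]` meets
`N(⋆)`. The corresponding localization of the Nagata ring is `D_M(X)`, which is a discrete valuation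
ring exactly when `D_M` is one. Hence `D` is a `⋆`-almost Dedekind domain if and only if the Nagata
ring is an almost Dedekind domain.

For the Kronecker function ring, let `D_M` be a valuation ring with `M` quasi-`⋆_f`-maximal. Then
`D^⋆ ⊆ D_M`, and finitely generated ideals of `D_M` are principal, so that an inclusion
`(c(f)c(h))^⋆ ⊆ (c(g)c(h))^⋆` implies `c(f)D_M ⊆ c(g)D_M`, which places `f / g` in `D[X]_{M[X]}`
(`SemistarOp.IsQuasiMaximal.exists_mul_eq_mul_of_star_le`). If this holds at every `M`, the
denominators of `f / g` lie in no `M[X]`, so one of them belongs to `N(⋆)`, and the two rings agree.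
The Bézout property follows, as `f` and `g` are both multiples of `f + X ^ k * g` in the Kronecker
function ring when `k` exceeds the degree of `f`.

The comparison with Prüfer domains is a fact about an arbitrary domain `R` that is not a field. If
`R` is an almost Dedekind domain, it has dimension one, and an idempotent maximal ideal would
localize to an idempotent maximal ideal of a discrete valuation ring. Conversely, a Prüfer domain
localizes to valuation rings, where a non-idempotent maximal ideal is principal; in dimension one
this leaves a discrete valuation ring (`IsPruferDomain.isAlmostDedekindDomain`).
-/

/-! ### Discrete valuation rings as localizations at a prime -/

theorem IsDiscreteValuationRing.of_maximalIdeal_eq_span {S : Type*} [CommRing S] [IsDomain S]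
    [IsLocalRing S] {p : S} (hp : p ≠ 0) (hm : IsLocalRing.maximalIdeal S = Ideal.span {p})
    (h : ∀ q : Ideal S, q.IsPrime → q ≠ ⊥ → q = IsLocalRing.maximalIdeal S) :
    IsDiscreteValuationRing S :=
  { toIsPrincipalIdealRing := .of_prime_ne_bot fun q hq hq0 => ⟨p, by rw [h q hq hq0, hm]⟩
    not_a_field' := by
      rw [hm, Ne, Ideal.span_singleton_eq_bot]
      exact hp }

/-- Divisibility in the localization of `R` at the prime `P` is a total relation, that is, `R_P` is
a valuation ring. It is phrased by elements of `R`: up to a factor outside `P`, one of any two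
elements is a multiple of the other. -/
def IsValuationAtPrime {R : Type*} [CommRing R] (P : Ideal R) : Prop :=
  ∀ a b : R, (∃ t ∉ P, ∃ c, t * a = c * b) ∨ ∃ t ∉ P, ∃ c, t * b = c * a

section AtPrime

variable {R : Type*} [CommRing R] (P : Ideal R) [P.IsPrime]

theorem Localization.AtPrime.exists_mul_algebraMap_eq (x : Localization.AtPrime P) :
    ∃ a : R, ∃ t ∉ P, x * algebraMap R _ t = algebraMap R _ a := by
  obtain ⟨⟨a, t⟩, h⟩ := IsLocalization.surj P.primeCompl x
  exact ⟨a, t, t.2, h⟩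

theorem Localization.AtPrime.associated_algebraMap {t : R} (ht : t ∉ P)
    (x : Localization.AtPrime P) : Associated x (x * algebraMap R _ t) :=
  ⟨((IsLocalization.AtPrime.isUnit_to_map_iff _ P t).2 ht).unit, rfl⟩

variable [IsDomain R]

theorem Localization.AtPrime.algebraMap_injective :
    Function.Injective (algebraMap R (Localization.AtPrime P)) :=
  IsLocalization.injective _ P.primeCompl_le_nonZeroDivisors

variable {P} in
/-- If, up to factors outside `P`, every nonzero element of `R` is a power of `π ∈ P`, then `R_P` is
a discrete valuation ring: a nonzero prime of `R_P` contains a power of `π`, hence `π`, and `π`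
generates the maximal ideal. -/
theorem isDiscreteValuationRing_atPrime_of_forall {π : R} (hπ : π ∈ P) (hπ0 : π ≠ 0)
    (h : ∀ a : R, a ≠ 0 → ∃ n : ℕ, ∃ s ∉ P, ∃ t ∉ P, s * a = t * π ^ n) :
    IsDiscreteValuationRing (Localization.AtPrime P) := by
  have hmem : algebraMap R (Localization.AtPrime P) π ∈
      IsLocalRing.maximalIdeal (Localization.AtPrime P) :=
    (IsLocalization.AtPrime.to_map_mem_maximal_iff _ P π).2 hπ
  have key : ∀ x : Localization.AtPrime P, x ≠ 0 →
      ∃ n : ℕ, Associated (algebraMap R (Localization.AtPrime P) π ^ n) x := by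
    intro x hx
    obtain ⟨a, u, hu, hxa⟩ := Localization.AtPrime.exists_mul_algebraMap_eq P x
    have hass := Localization.AtPrime.associated_algebraMap P hu x
    rw [hxa] at hass
    have ha : a ≠ 0 := by
      rintro rfl
      exact hx (hass.eq_zero_iff.2 (map_zero _))
    obtain ⟨n, s, hs, t, ht, hst⟩ := h a ha
    have h1 := Localization.AtPrime.associated_algebraMap P hs (algebraMap R _ a)
    have h2 := Localization.AtPrime.associated_algebraMap P ht (algebraMap R _ (π ^ n))
    rw [← map_mul, mul_comm] at h1 h2
    rw [hst] at h1
    exact ⟨n, by rw [← map_pow]; exact h2.trans (h1.symm.trans hass.symm)⟩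
  refine IsDiscreteValuationRing.of_maximalIdeal_eq_span
    (p := algebraMap R (Localization.AtPrime P) π) ?_ (le_antisymm ?_ ?_) ?_
  · rw [Ne, ← map_zero (algebraMap R _)]
    exact fun h => hπ0 (Localization.AtPrime.algebraMap_injective P h)
  · intro x hx
    by_cases hx0 : x = 0
    · rw [hx0]; exact zero_mem _
    obtain ⟨n, hn⟩ := key x hx0
    rw [Ideal.mem_span_singleton]
    rcases n with - | n
    · rw [pow_zero] at hn
      exact ((IsLocalRing.mem_maximalIdeal x).1 hx (hn.symm.isUnit_iff.2 isUnit_one)).elim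
    · exact (dvd_pow_self _ n.succ_ne_zero).trans hn.dvd
  · rwa [Ideal.span_singleton_le_iff_mem]
  · intro q hq hq0
    obtain ⟨x, hxq, hx0⟩ := Submodule.exists_mem_ne_zero_of_ne_bot hq0
    obtain ⟨n, hn⟩ := key x hx0
    have hpq := hq.mem_of_pow_mem n (Ideal.mem_of_dvd _ hn.symm.dvd hxq)
    refine le_antisymm (IsLocalRing.le_maximalIdeal hq.ne_top) fun y hy => ?_
    by_cases hy0 : y = 0
    · rw [hy0]; exact zero_mem _
    obtain ⟨m, hm⟩ := key y hy0
    rcases m with - | m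
    · rw [pow_zero] at hm
      exact ((IsLocalRing.mem_maximalIdeal y).1 hy (hm.symm.isUnit_iff.2 isUnit_one)).elim
    · exact Ideal.mem_of_dvd _ ((dvd_pow_self _ m.succ_ne_zero).trans hm.dvd) hpq

/-- A uniformizer of `R_P` can be found among any elements that generate `P`: if the image of `I`
had valuation at least `2` throughout, so would the maximal ideal that it generates. -/
theorem exists_irreducible_algebraMap_of_map_eq [IsDiscreteValuationRing (Localization.AtPrime P)]
    {A : Type*} [CommRing A] (f : A →+* R) {I : Ideal A} (hI : I.map f = P) :
    ∃ a ∈ I, Irreducible (algebraMap R (Localization.AtPrime P) (f a)) := by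
  obtain ⟨ϖ, hϖ⟩ := IsDiscreteValuationRing.exists_irreducible (Localization.AtPrime P)
  have hmax : IsLocalRing.maximalIdeal (Localization.AtPrime P) =
      I.map ((algebraMap R (Localization.AtPrime P)).comp f) := by
    rw [← Ideal.map_map, hI, Localization.AtPrime.map_eq_maximalIdeal]
  by_contra! hno
  -- Otherwise all generators of the maximal ideal are divisible by `ϖ ^ 2`.
  have hle : IsLocalRing.maximalIdeal (Localization.AtPrime P) ≤ Ideal.span {ϖ ^ 2} := by
    rw [hmax, Ideal.map_le_iff_le_comap]
    intro a ha
    rw [Ideal.mem_comap, RingHom.comp_apply, Ideal.mem_span_singleton]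
    set x := algebraMap R (Localization.AtPrime P) (f a)
    by_cases hx0 : x = 0
    · rw [hx0]; exact dvd_zero _
    obtain ⟨n, hn⟩ := IsDiscreteValuationRing.associated_pow_irreducible hx0 hϖ
    have hxm : x ∈ IsLocalRing.maximalIdeal (Localization.AtPrime P) := by
      rw [hmax]; exact Ideal.mem_map_of_mem _ ha
    rcases n with - | - | n
    · rw [pow_zero] at hn
      exact ((IsLocalRing.mem_maximalIdeal x).1 hxm (hn.isUnit_iff.2 isUnit_one)).elim
    · rw [zero_add, pow_one] at hn
      exact (hno a ha (hn.symm.irreducible hϖ)).elim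
    · exact (pow_dvd_pow ϖ (by omega)).trans hn.symm.dvd
  have h1 : ϖ ∈ Ideal.span {ϖ ^ 2} :=
    hle ((IsLocalRing.mem_maximalIdeal ϖ).2 hϖ.not_isUnit)
  rw [Ideal.mem_span_singleton] at h1
  have h2 := (pow_dvd_pow_iff (n := 2) (m := 1) hϖ.ne_zero hϖ.not_isUnit).1 (by rwa [pow_one])
  omega

variable {P} in
theorem exists_mul_eq_mul_pow_of_irreducible [IsDiscreteValuationRing (Localization.AtPrime P)]
    {π : R} (hπ : Irreducible (algebraMap R (Localization.AtPrime P) π)) {a : R} (ha : a ≠ 0) :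
    ∃ n : ℕ, ∃ s ∉ P, ∃ t ∉ P, s * a = t * π ^ n := by
  have hinj := Localization.AtPrime.algebraMap_injective P
  have ha' : algebraMap R (Localization.AtPrime P) a ≠ 0 := by
    rw [Ne, ← map_zero (algebraMap R _)]
    exact fun h => ha (hinj h)
  obtain ⟨n, hn⟩ := IsDiscreteValuationRing.associated_pow_irreducible ha' hπ
  obtain ⟨u, hu⟩ := hn.symm
  obtain ⟨t, s, hs, hst⟩ := Localization.AtPrime.exists_mul_algebraMap_eq P (u : _)
  refine ⟨n, s, hs, t, ?_, hinj ?_⟩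
  · rw [← Ideal.mem_primeCompl_iff,
      ← IsLocalization.AtPrime.isUnit_to_map_iff (Localization.AtPrime P) P, ← hst]
    exact u.isUnit.mul ((IsLocalization.AtPrime.isUnit_to_map_iff _ P s).2 hs)
  · rw [map_mul, map_mul, map_pow, ← hu, ← hst]
    ring

theorem exists_uniformizer_of_isDiscreteValuationRing_atPrime
    [IsDiscreteValuationRing (Localization.AtPrime P)] :
    ∃ π ∈ P, π ≠ 0 ∧ ∀ a : R, a ≠ 0 → ∃ n : ℕ, ∃ s ∉ P, ∃ t ∉ P, s * a = t * π ^ n := by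
  obtain ⟨π, hπ, hirr⟩ := exists_irreducible_algebraMap_of_map_eq P (RingHom.id R) P.map_id
  refine ⟨π, hπ, ?_, fun a ha => exists_mul_eq_mul_pow_of_irreducible hirr ha⟩
  rintro rfl
  exact hirr.ne_zero (map_zero _)

theorem IsValuationAtPrime.of_isDiscreteValuationRing
    [IsDiscreteValuationRing (Localization.AtPrime P)] : IsValuationAtPrime P := by
  intro a b
  have hone : (1 : R) ∉ P := fun h => Ideal.IsPrime.ne_top' ((Ideal.eq_top_iff_one P).2 h)
  by_cases ha : a = 0
  · exact .inl ⟨1, hone, 0, by simp [ha]⟩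
  by_cases hb : b = 0
  · exact .inr ⟨1, hone, 0, by simp [hb]⟩
  obtain ⟨π, -, -, h⟩ := exists_uniformizer_of_isDiscreteValuationRing_atPrime P
  have hmul : ∀ {x y : R}, x ∉ P → y ∉ P → x * y ∉ P := fun hx hy hxy =>
    ((Ideal.IsPrime.mem_or_mem ‹_›) hxy).elim hx hy
  have key : ∀ {x y s t s' t' : R} {m n : ℕ}, m ≤ n → s ∉ P → t' ∉ P → s * x = t * π ^ n →
      s' * y = t' * π ^ m → ∃ t ∉ P, ∃ c, t * x = c * y := by
    intro x y s t s' t' m n hmn hs ht' hx hy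
    refine ⟨t' * s, hmul ht' hs, t * π ^ (n - m) * s', ?_⟩
    rw [mul_assoc, hx, mul_assoc, hy, ← Nat.sub_add_cancel hmn, pow_add, Nat.add_sub_cancel]
    ring
  obtain ⟨n, s, hs, t, ht, hst⟩ := h a ha
  obtain ⟨m, s', hs', t', ht', hst'⟩ := h b hb
  rcases le_total m n with hmn | hmn
  · exact .inl (key hmn hs ht' hst hst')
  · exact .inr (key hmn hs' ht hst' hst)

end AtPrime

/-! ### Almost Dedekind domains and Prüfer domains -/

section Prufer

/-- The square of a maximal ideal is primary, so it is recovered from its localization. -/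
theorem Ideal.isIdempotentElem_of_maximalIdeal_atPrime {R : Type*} [CommRing R]
    {M : Ideal R} [hM : M.IsMaximal]
    (h : IsIdempotentElem (IsLocalRing.maximalIdeal (Localization.AtPrime M))) :
    IsIdempotentElem M := by
  refine le_antisymm Ideal.mul_le_left fun x hx => ?_
  have hx' : algebraMap R (Localization.AtPrime M) x ∈
      (M * M).map (algebraMap R (Localization.AtPrime M)) := by
    rw [Ideal.map_mul, Localization.AtPrime.map_eq_maximalIdeal, h.eq]
    exact (IsLocalization.AtPrime.to_map_mem_maximal_iff _ M x).2 hx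
  obtain ⟨t, ht, htx⟩ :=
    (IsLocalization.algebraMap_mem_map_algebraMap_iff M.primeCompl _ _ _).1 hx'
  obtain ⟨r, m, hm, hrm⟩ := hM.exists_inv ht
  have : x = r * (t * x) + m * x := by rw [← mul_assoc, ← add_mul, hrm, one_mul]
  rw [this]
  exact add_mem (Ideal.mul_mem_left _ r htx) (Ideal.mul_mem_mul hm hx)

variable {R : Type*} [CommRing R] [IsDomain R]

/-- For `0 ≠ Q ≤ M` with `M` maximal, `Q` contains a uniformizer of `R_M`, hence all of `M`. -/
theorem IsAlmostDedekindDomain.isMaximal_of_isPrime (h : IsAlmostDedekindDomain R) {Q : Ideal R}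
    (hQ : Q.IsPrime) (hQ0 : Q ≠ ⊥) : Q.IsMaximal := by
  obtain ⟨M, hM, hQM⟩ := Q.exists_le_maximal hQ.ne_top
  have := h M (fun hM0 => hQ0 (le_bot_iff.1 (hM0 ▸ hQM)))
  obtain ⟨π, hπ, -, hfac⟩ := exists_uniformizer_of_isDiscreteValuationRing_atPrime M
  obtain ⟨x, hxQ, hx0⟩ := Submodule.exists_mem_ne_zero_of_ne_bot hQ0
  obtain ⟨n, s, hs, t, ht, hst⟩ := hfac x hx0
  have hπQ : π ∈ Q := by
    have := hst ▸ Q.mul_mem_left s hxQ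
    exact hQ.mem_of_pow_mem n ((hQ.mem_or_mem this).resolve_left fun h => ht (hQM h))
  suffices M ≤ Q from (le_antisymm hQM this) ▸ hM
  intro y hy
  by_cases hy0 : y = 0
  · rw [hy0]; exact zero_mem _
  obtain ⟨m, s', hs', t', ht', hst'⟩ := hfac y hy0
  have hm : m ≠ 0 := by
    rintro rfl
    rw [pow_zero, mul_one] at hst'
    exact ht' (hst' ▸ M.mul_mem_left _ hy)
  have := Q.mul_mem_left t' (Q.pow_mem_of_mem hπQ m (Nat.pos_of_ne_zero hm))
  rw [← hst'] at this
  exact (hQ.mem_or_mem this).resolve_left fun h => hs' (hQM h)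

theorem IsAlmostDedekindDomain.ringKrullDim_eq_one (h : IsAlmostDedekindDomain R)
    (hR : ¬ IsField R) : ringKrullDim R = 1 := by
  have h1 : Ring.KrullDimLE 1 R :=
    Ring.KrullDimLE.mk₁' fun I hI hI' => h.isMaximal_of_isPrime hI' hI
  refine eq_of_le_of_not_lt (Ring.krullDimLE_iff (n := 1).1 h1) fun hlt => hR ?_
  have : Ring.KrullDimLE 0 R := Ring.krullDimLE_iff.2 (ENat.WithBot.lt_add_one_iff.1 hlt)
  exact Ring.KrullDimLE.isField_of_isDomain

theorem IsAlmostDedekindDomain.not_isIdempotentElem (h : IsAlmostDedekindDomain R)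
    (hR : ¬ IsField R) {M : Ideal R} (hM : M.IsMaximal) : ¬ IsIdempotentElem M := by
  intro hid
  have hM0 : M ≠ ⊥ := Ring.ne_bot_of_isMaximal_of_not_isField hM hR
  have := h M hM0
  have hid' : IsIdempotentElem (IsLocalRing.maximalIdeal (Localization.AtPrime M)) := by
    rw [← Localization.AtPrime.map_eq_maximalIdeal, IsIdempotentElem, ← Ideal.map_mul, hid.eq]
  rcases (Ideal.isIdempotentElem_iff_eq_bot_or_top _ (IsNoetherian.noetherian _)).1 hid' with h | h
  · exact IsDiscreteValuationRing.not_a_field _ h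
  · exact (IsLocalRing.maximalIdeal.isMaximal _).ne_top h

theorem IsPruferDomain.of_isBezout [IsBezout R] : IsPruferDomain R := by
  intro I hI0 hI
  obtain ⟨a, rfl⟩ := (IsBezout.isPrincipal_of_FG I hI).principal
  rw [Ideal.submodule_span_eq, FractionalIdeal.coeIdeal_span_singleton]
  have ha : algebraMap R (FractionRing R) a ≠ 0 := by
    rw [Ne, FaithfulSMul.algebraMap_eq_zero_iff]
    rintro rfl
    simp at hI0
  refine IsUnit.of_mul_eq_one (FractionalIdeal.spanSingleton _ (algebraMap R _ a)⁻¹) ?_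
  rw [FractionalIdeal.spanSingleton_mul_spanSingleton, mul_inv_cancel₀ ha,
    FractionalIdeal.spanSingleton_one]

/-- If `J` is inverse to `(a, b)`, then `1 = a x + b y` with `x, y ∈ J`. The elements `a x`, `b x`,
`a y`, `b y` lie in `R`, and `a x`, `b y` are not both in `P`; accordingly `a` divides `b`, or
`b` divides `a`, in `R_P`. -/
theorem IsPruferDomain.isValuationAtPrime (h : IsPruferDomain R) (P : Ideal R) [P.IsPrime] :
    IsValuationAtPrime P := by
  intro a b
  have hone : (1 : R) ∉ P := fun h => Ideal.IsPrime.ne_top' ((Ideal.eq_top_iff_one P).2 h)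
  by_cases ha : a = 0
  · exact .inl ⟨1, hone, 0, by simp [ha]⟩
  have hI : Ideal.span {a, b} ≠ ⊥ := by
    rw [Ne, Ideal.span_eq_bot]
    exact fun h => ha (h a (by simp))
  obtain ⟨J, hJ⟩ := (h _ hI (Submodule.fg_span (Set.toFinite _))).exists_right_inv
  let F := FractionRing R
  have hle : ∀ x ∈ J, ∀ y ∈ Ideal.span {a, b}, ∃ c, algebraMap R F c = algebraMap R F y * x := by
    intro x hx y hy
    have := FractionalIdeal.mul_mem_mul (FractionalIdeal.mem_coeIdeal_of_mem _ hy) hx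
    rw [hJ] at this
    exact (FractionalIdeal.mem_one_iff _).1 this
  have h1 : (1 : F) ∈
      ((Ideal.span {a, b} : Ideal R) : FractionalIdeal (nonZeroDivisors R) F) * J := by
    rw [hJ]; exact FractionalIdeal.one_mem_one _
  have h2 : ∀ z ∈ ((Ideal.span {a, b} : Ideal R) : FractionalIdeal (nonZeroDivisors R) F) * J,
      ∃ x ∈ J, ∃ y ∈ J, z = algebraMap R F a * x + algebraMap R F b * y := by
    intro z hz
    refine FractionalIdeal.mul_induction_on hz (fun i hi j hj => ?_) ?_
    · obtain ⟨i, hi' : i ∈ Ideal.span {a, b}, rfl⟩ := (FractionalIdeal.mem_coeIdeal _).1 hi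
      obtain ⟨c, d, rfl⟩ := Ideal.mem_span_pair.1 hi'
      refine ⟨c • j, Submodule.smul_mem _ c hj, d • j, Submodule.smul_mem _ d hj, ?_⟩
      simp only [Algebra.smul_def, map_add, map_mul]
      ring
    · rintro z w ⟨x, hx, y, hy, rfl⟩ ⟨x', hx', y', hy', rfl⟩
      exact ⟨x + x', Submodule.add_mem J.val hx hx', y + y', Submodule.add_mem J.val hy hy',
        by ring⟩
  obtain ⟨x, hx, y, hy, hxy⟩ := h2 1 h1
  have haI : a ∈ Ideal.span {a, b} := Ideal.subset_span (by simp)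
  have hbI : b ∈ Ideal.span {a, b} := Ideal.subset_span (by simp)
  obtain ⟨xa, hxa⟩ := hle x hx a haI
  obtain ⟨xb, hxb⟩ := hle x hx b hbI
  obtain ⟨ya, hya⟩ := hle y hy a haI
  obtain ⟨yb, hyb⟩ := hle y hy b hbI
  have hinj := FaithfulSMul.algebraMap_injective R F
  have hsum : xa + yb = 1 := hinj (by rw [map_add, hxa, hyb, map_one, hxy])
  by_cases hxP : xa ∈ P
  · refine .inl ⟨yb, fun hyP => hone (hsum ▸ P.add_mem hxP hyP), ya, hinj ?_⟩
    rw [map_mul, map_mul, hyb, hya]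
    ring
  · refine .inr ⟨xa, hxP, xb, hinj ?_⟩
    rw [map_mul, map_mul, hxa, hxb]
    ring

/-- `R_M` is a valuation ring with non-idempotent maximal ideal `m`, so any element of `m` outside
`m²` generates `m`; as the dimension is one, `m` is the only nonzero prime of `R_M`. -/
theorem IsPruferDomain.isAlmostDedekindDomain (h : IsPruferDomain R) (hdim : ringKrullDim R ≤ 1)
    (hid : ∀ M : Ideal R, M.IsMaximal → ¬ IsIdempotentElem M) : IsAlmostDedekindDomain R := by
  intro M hM hM0
  have hdim' : Ring.KrullDimLE 1 R := Ring.krullDimLE_iff.2 hdim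
  let S := Localization.AtPrime M
  have htotal : ∀ x y : S, x ∣ y ∨ y ∣ x := by
    have key : ∀ {a b : R} {t : R}, t ∉ M → ∀ c, t * a = c * b →
        algebraMap R S b ∣ algebraMap R S a := by
      intro a b t ht c htc
      rw [(Localization.AtPrime.associated_algebraMap M ht (algebraMap R S a)).dvd_iff_dvd_right,
        ← map_mul, mul_comm, htc, map_mul]
      exact dvd_mul_left _ _
    intro x y
    obtain ⟨a, u, hu, hxa⟩ := Localization.AtPrime.exists_mul_algebraMap_eq M x
    obtain ⟨b, v, hv, hyb⟩ := Localization.AtPrime.exists_mul_algebraMap_eq M y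
    have hx := Localization.AtPrime.associated_algebraMap M hu x
    have hy := Localization.AtPrime.associated_algebraMap M hv y
    rw [hxa] at hx
    rw [hyb] at hy
    rw [hx.dvd_iff_dvd_left, hy.dvd_iff_dvd_right, hy.dvd_iff_dvd_left, hx.dvd_iff_dvd_right]
    rcases h.isValuationAtPrime M a b with ⟨t, ht, c, hc⟩ | ⟨t, ht, c, hc⟩
    · exact .inr (key ht c hc)
    · exact .inl (key ht c hc)
  obtain ⟨x, hx, hx2⟩ : ∃ x ∈ IsLocalRing.maximalIdeal S,
      x ∉ IsLocalRing.maximalIdeal S * IsLocalRing.maximalIdeal S := by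
    by_contra! hcon
    exact hid M hM
      (Ideal.isIdempotentElem_of_maximalIdeal_atPrime (le_antisymm Ideal.mul_le_left hcon))
  refine IsDiscreteValuationRing.of_maximalIdeal_eq_span (p := x) ?_ (le_antisymm ?_ ?_) ?_
  · rintro rfl
    exact hx2 (zero_mem _)
  · intro y hy
    rw [Ideal.mem_span_singleton]
    by_contra hxy
    obtain ⟨z, rfl⟩ := (htotal x y).resolve_left hxy
    refine hx2 (Ideal.mul_mem_mul hy ((IsLocalRing.mem_maximalIdeal z).2 fun hz => hxy ?_))
    exact (hz.mul_right_dvd).2 dvd_rfl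
  · rwa [Ideal.span_singleton_le_iff_mem]
  · intro q hq hq0
    have hqc : q.comap (algebraMap R S) ≠ ⊥ := by
      intro hbot
      refine hq0 ?_
      rw [← IsLocalization.map_under M.primeCompl S q]
      exact (congrArg _ hbot).trans Ideal.map_bot
    have : (q.comap (algebraMap R S)).IsMaximal :=
      (hq.comap _).isMaximal_of_ne_bot hqc
    have hle : q.comap (algebraMap R S) ≤ M := fun x hx =>
      (IsLocalization.AtPrime.to_map_mem_maximal_iff S M x).1
        (IsLocalRing.le_maximalIdeal hq.ne_top hx)
    exact (Localization.AtPrime.eq_maximalIdeal_iff_under_eq (J := q)).1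
      (this.eq_of_le hM.ne_top hle)

end Prufer

/-! ### Polynomials and their contents -/

namespace IsValuationAtPrime

variable {R : Type*} [CommRing R] {P : Ideal R} [P.IsPrime]

/-- Among finitely many elements, one divides all the others in the valuation ring `R_P`. -/
theorem exists_dominant (hP : IsValuationAtPrime P) (b : ℕ → R) {S : Finset ℕ} (hS : S.Nonempty) :
    ∃ i ∈ S, ∃ t ∉ P, ∀ j ∈ S, b i ∣ t * b j := by
  have hone : (1 : R) ∉ P := fun h => Ideal.IsPrime.ne_top' ((Ideal.eq_top_iff_one P).2 h)
  induction hS using Finset.Nonempty.cons_induction with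
  | singleton a => exact ⟨a, by simp, 1, hone, by simp⟩
  | cons a S ha hS ih =>
    obtain ⟨i, hi, t, ht, h⟩ := ih
    rcases hP (b a) (b i) with ⟨u, hu, c, hc⟩ | ⟨u, hu, c, hc⟩
    · refine ⟨i, by simp [hi], u * t, fun h => (Ideal.IsPrime.mem_or_mem ‹_› h).elim hu ht, ?_⟩
      intro j hj
      rcases Finset.mem_cons.1 hj with rfl | hj
      · exact ⟨t * c, by rw [mul_right_comm, hc]; ring⟩
      · rw [mul_assoc]
        exact (h j hj).mul_left u
    · refine ⟨a, by simp, u * t, fun h => (Ideal.IsPrime.mem_or_mem ‹_› h).elim hu ht, ?_⟩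
      intro j hj
      rcases Finset.mem_cons.1 hj with rfl | hj
      · exact dvd_mul_left _ _
      · obtain ⟨d, hd⟩ := h j hj
        exact ⟨c * d, by rw [mul_assoc, hd, ← mul_assoc, hc]; ring⟩

/-- Over the valuation ring `R_P` a nonzero polynomial is one of its coefficients times a polynomial
with a unit coefficient. -/
theorem exists_coeff_mul [IsDomain R] (hP : IsValuationAtPrime P) {f : R[X]} (hf : f ≠ 0) :
    ∃ i, f.coeff i ≠ 0 ∧ ∃ t ∉ P, ∃ f' ∉ P.map Polynomial.C,
      Polynomial.C t * f = Polynomial.C (f.coeff i) * f' := by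
  obtain ⟨i, hi, t, ht, h⟩ := hP.exists_dominant f.coeff (Polynomial.support_nonempty.2 hf)
  have hi0 := Polynomial.mem_support_iff.1 hi
  have hdvd : Polynomial.C (f.coeff i) ∣ Polynomial.C t * f := by
    rw [Polynomial.C_dvd_iff_dvd_coeff]
    intro j
    rw [Polynomial.coeff_C_mul]
    by_cases hj : j ∈ f.support
    · exact h j hj
    · rw [Polynomial.notMem_support_iff.1 hj, mul_zero]
      exact dvd_zero _
  obtain ⟨f', hf'⟩ := hdvd
  refine ⟨i, hi0, t, ht, f', fun hmem => ht ?_, hf'⟩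
  have := congrArg (fun p => Polynomial.coeff p i) hf'
  simp only [Polynomial.coeff_C_mul] at this
  rw [mul_comm] at this
  rw [mul_left_cancel₀ hi0 this]
  exact Ideal.mem_map_C_iff.1 hmem i

end IsValuationAtPrime

/-- For `k` greater than the degree of `f`, the coefficients of `f + X ^ k * g` are those of `f`
together with those of `g`. -/
theorem Polynomial.exists_contentIdeal_ge {R : Type*} [CommRing R] (f g : R[X]) :
    ∃ k : ℕ, f.contentIdeal ≤ (f + X ^ k * g).contentIdeal ∧
      g.contentIdeal ≤ (f + X ^ k * g).contentIdeal := by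
  have hle : ∀ {p q : R[X]}, (∀ i, p.coeff i ∈ q.contentIdeal) →
      p.contentIdeal ≤ q.contentIdeal := by
    intro p q h
    rw [contentIdeal_def, Ideal.span_le]
    intro a ha
    obtain ⟨n, -, rfl⟩ := mem_coeffs_iff.1 (Finset.mem_coe.1 ha)
    exact h n
  refine ⟨f.natDegree + 1, hle fun i => ?_, hle fun i => ?_⟩
  · by_cases hi : i < f.natDegree + 1
    · have := (f + X ^ (f.natDegree + 1) * g).coeff_mem_contentIdeal i
      rwa [coeff_add, coeff_X_pow_mul', if_neg (by omega), add_zero] at this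
    · rw [coeff_eq_zero_of_natDegree_lt (by omega)]
      exact zero_mem _
  · have := (f + X ^ (f.natDegree + 1) * g).coeff_mem_contentIdeal (i + (f.natDegree + 1))
    rwa [coeff_add, coeff_X_pow_mul, coeff_eq_zero_of_natDegree_lt (by omega), zero_add] at this

namespace SemistarOp

open Polynomial

variable {D K : Type*} [CommRing D] [Field K] [Algebra D K]

/-! ### Quasi-maximal ideals -/

theorem star_eq_star_one (s : SemistarOp D K) {I : Ideal D} (h : 1 ∈ s.star (toSub K I)) :
    s.star (toSub K I) = s.star 1 := by
  refine le_antisymm (s.star_toSub_le I) ?_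
  have := s.star_mono _ _ (Submodule.one_le.2 h)
  rwa [s.star_star] at this

theorem toSub_fg {I : Ideal D} (h : I.FG) : (toSub K I).FG := Submodule.FG.map _ h

/-- Finitely generated submodules see the union of a directed family of ideals at a finite stage.
This is what finite type gains over an arbitrary semistar operation. -/
theorem exists_le_of_fg_of_directed {C : Set (Ideal D)} (hne : C.Nonempty)
    (hC : DirectedOn (· ≤ ·) C) {G : Submodule D K} (hG : G.FG) (hle : G ≤ toSub K (sSup C)) :
    ∃ I ∈ C, G ≤ toSub K I := by
  induction G, hG using Submodule.fg_induction with
  | singleton x =>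
    obtain ⟨a, ha, rfl⟩ := (IsLocalization.mem_coeSubmodule K _).1
      (hle (Submodule.mem_span_singleton_self x))
    obtain ⟨I, hI, haI⟩ := (Submodule.mem_sSup_of_directed hne hC).1 ha
    exact ⟨I, hI, (Submodule.span_singleton_le_iff_mem _ _).2
      ((IsLocalization.mem_coeSubmodule K _).2 ⟨a, haI, rfl⟩)⟩
  | sup G₁ G₂ _ _ ih₁ ih₂ =>
    obtain ⟨I₁, h₁, h₁G⟩ := ih₁ (le_sup_left.trans hle)
    obtain ⟨I₂, h₂, h₂G⟩ := ih₂ (le_sup_right.trans hle)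
    obtain ⟨I, hI, hI₁, hI₂⟩ := hC I₁ h₁ I₂ h₂
    exact ⟨I, hI, sup_le (h₁G.trans (IsLocalization.coeSubmodule_mono K hI₁))
      (h₂G.trans (IsLocalization.coeSubmodule_mono K hI₂))⟩

/-- A nonzero ideal whose `⋆_f`-closure omits `1` lies in a quasi-`⋆_f`-maximal ideal, by Zorn's
lemma: a union of a chain of quasi-`⋆_f`-ideals is a quasi-`⋆_f`-ideal. -/
theorem exists_isQuasiMaximal (s : SemistarOp D K) {I : Ideal D} (hI : I ≠ ⊥)
    (h1 : (1 : K) ∉ s.finType.star (toSub K I)) :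
    ∃ M, s.finType.IsQuasiMaximal M ∧ I ≤ M := by
  have hmem : ∀ J : Ideal D, s.finType.starInter J ≠ ⊤ ↔ (1 : K) ∉ s.finType.star (toSub K J) := by
    intro J
    rw [Ne, Ideal.eq_top_iff_one, mem_starInter, map_one]
  suffices hchain : ∀ C ⊆ {J | s.finType.IsQuasiIdeal J ∧ J ≠ ⊤}, IsChain (· ≤ ·) C → ∀ J ∈ C,
      ∃ ub ∈ {J | s.finType.IsQuasiIdeal J ∧ J ≠ ⊤}, ∀ z ∈ C, z ≤ ub by
    obtain ⟨M, hIM, hM⟩ := zorn_le_nonempty₀ _ hchain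
      (s.finType.starInter I) ⟨s.finType.isQuasiIdeal_starInter hI, (hmem I).2 h1⟩
    exact ⟨M, hM, (s.finType.le_starInter I).trans hIM⟩
  intro C hCs hC J hJ
  have hdir : DirectedOn (· ≤ ·) C := hC.directedOn
  refine ⟨sSup C, ⟨⟨fun h => (hCs hJ).1.1 (le_bot_iff.1 (h ▸ le_sSup hJ)),
    le_antisymm (s.finType.le_starInter _) ?_⟩, ?_⟩, fun z hz => le_sSup hz⟩
  · rintro a ⟨G, hG, hGC, ha⟩
    obtain ⟨L, hL, hGL⟩ := exists_le_of_fg_of_directed ⟨J, hJ⟩ hdir hG hGC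
    have : a ∈ s.finType.starInter L := ⟨G, hG, hGL, ha⟩
    rw [← (hCs hL).1.2] at this
    exact le_sSup hL this
  · rw [Ne, Ideal.eq_top_iff_one, Submodule.mem_sSup_of_directed ⟨J, hJ⟩ hdir]
    rintro ⟨L, hL, h⟩
    exact (hCs hL).2 ((Ideal.eq_top_iff_one L).2 h)

theorem IsQuasiMaximal.one_notMem {s : SemistarOp D K} {M : Ideal D} (hM : s.IsQuasiMaximal M) :
    (1 : K) ∉ s.star (toSub K M) := by
  intro h
  refine hM.prop.2 ((Ideal.eq_top_iff_one M).2 ?_)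
  rw [hM.prop.1.2, mem_starInter, map_one]
  exact h

/-- If `D_M` is a valuation ring, then `D^⋆ ⊆ D_M`: otherwise `D^⋆` contains some `t / c` with
`t ∉ M` and `c ∈ M`, so that `t ∈ (cD)^⋆ ∩ D ⊆ M^{⋆_f} ∩ D = M`. -/
theorem IsQuasiMaximal.exists_mul_eq_mul_of_div_mem_star_one [FaithfulSMul D K]
    {s : SemistarOp D K} {M : Ideal D}
    (hM : s.finType.IsQuasiMaximal M) (hval : IsValuationAtPrime M) {a b : D} (hb : b ≠ 0)
    (h : algebraMap D K a / algebraMap D K b ∈ s.star 1) : ∃ t ∉ M, ∃ c, t * a = c * b := by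
  rcases hval a b with h' | ⟨t, ht, c, hc⟩
  · exact h'
  by_cases hcM : c ∈ M
  · have hb' : algebraMap D K b ≠ 0 := by rwa [Ne, FaithfulSMul.algebraMap_eq_zero_iff]
    refine (ht ?_).elim
    rw [hM.prop.1.2]
    refine ⟨toSub K (Ideal.span {c}), toSub_fg ⟨{c}, by simp⟩,
      IsLocalization.coeSubmodule_mono K (by rwa [Ideal.span_singleton_le_iff_mem]), ?_⟩
    have hle : algebraMap D K c • (1 : Submodule D K) ≤ toSub K (Ideal.span {c}) := by
      intro y hy
      obtain ⟨z, hz, rfl⟩ := Submodule.mem_smul_pointwise_iff_exists _ _ _ |>.1 hy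
      obtain ⟨d, rfl⟩ := Submodule.mem_one.1 hz
      exact (IsLocalization.mem_coeSubmodule K _).2
        ⟨c * d, Ideal.mul_mem_right _ _ (Ideal.mem_span_singleton_self c), by simp⟩
    have := s.smul_star_le _ hle (Submodule.smul_mem_pointwise_smul _ (algebraMap D K c) _ h)
    rwa [smul_eq_mul, ← mul_div_assoc, ← map_mul, ← hc, map_mul, mul_div_cancel_right₀ _ hb']
      at this
  · exact ⟨c, hcM, t, hc.symm⟩

variable [IsDomain D]

theorem IsQuasiMaximal.disjoint_nagataSet {s : SemistarOp D K} {M : Ideal D}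
    (hM : s.finType.IsQuasiMaximal M) :
    Disjoint (s.nagataSet : Set D[X]) (M.map C : Ideal D[X]) := by
  rw [Set.disjoint_left]
  rintro f ⟨-, hf⟩ hfM
  have hle : f.contentIdeal ≤ M := by
    rw [contentIdeal_def, Ideal.span_le]
    intro a ha
    obtain ⟨n, -, rfl⟩ := mem_coeffs_iff.1 (Finset.mem_coe.1 ha)
    exact Ideal.mem_map_C_iff.1 hfM n
  exact hM.one_notMem ⟨toSub K f.contentIdeal, toSub_fg f.contentIdeal_FG,
    IsLocalization.coeSubmodule_mono K hle, hf ▸ s.le_star _ (Submodule.one_le.1 le_rfl)⟩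

/-- An ideal of `D[X]` that lies in no `M[X]`, with `M` quasi-`⋆_f`-maximal, meets `N(⋆)`. The
contents of its members form a directed family; if `1` is in the `⋆_f`-closure of
their union, then it is in the closure of a single one of them. -/
theorem exists_mem_nagataSet (s : SemistarOp D K) {J : Ideal D[X]} (hJ : J ≠ ⊥)
    (h : ∀ M, s.finType.IsQuasiMaximal M → ¬ J ≤ M.map C) : ∃ f ∈ J, f ∈ s.nagataSet := by
  set S : Set (Ideal D) := contentIdeal '' (J : Set D[X])
  have hne : S.Nonempty := ⟨_, 0, zero_mem _, rfl⟩
  have hdir : DirectedOn (· ≤ ·) S := by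
    rintro _ ⟨f, hf, rfl⟩ _ ⟨g, hg, rfl⟩
    obtain ⟨k, hk₁, hk₂⟩ := exists_contentIdeal_ge f g
    exact ⟨_, ⟨_, J.add_mem hf (J.mul_mem_left _ hg), rfl⟩, hk₁, hk₂⟩
  have hcoeff : ∀ f ∈ J, ∀ n, f.coeff n ∈ sSup S := fun f hf n =>
    le_sSup (show f.contentIdeal ∈ S from ⟨f, hf, rfl⟩) (f.coeff_mem_contentIdeal n)
  by_contra! hN
  have hbot : sSup S ≠ ⊥ := by
    obtain ⟨f, hf, hf0⟩ := Submodule.exists_mem_ne_zero_of_ne_bot hJ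
    intro hbot
    refine hf0 (Polynomial.ext fun n => ?_)
    have := hcoeff f hf n
    rwa [hbot, Ideal.mem_bot] at this
  have hone : (1 : K) ∉ s.finType.star (toSub K (sSup S)) := by
    rintro ⟨G, hG, hGle, h1⟩
    obtain ⟨_, ⟨f, hf, rfl⟩, hGf⟩ := exists_le_of_fg_of_directed hne hdir hG hGle
    have h1f := s.star_mono _ _ hGf h1
    refine hN f hf ⟨?_, s.star_eq_star_one h1f⟩
    rintro rfl
    rw [contentIdeal_zero, toSub, IsLocalization.coeSubmodule_bot, s.star_bot] at h1f
    exact one_ne_zero ((Submodule.mem_bot D).1 h1f)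
  obtain ⟨M, hM, hle⟩ := s.exists_isQuasiMaximal hbot hone
  exact h M hM fun f hf => Ideal.mem_map_C_iff.2 fun n => hle (hcoeff f hf n)

/-! ### The Nagata ring as a localization of the polynomial ring -/

section Nagata

variable [FaithfulSMul D K]

/-- The Nagata ring as an algebra over the polynomial ring: `D[X] → Na(D,⋆)` is the corestriction
of the canonical map `D[X] → K(X)`. -/
noncomputable instance (s : SemistarOp D K) : Algebra D[X] s.nagata :=
  ((polyToRat D K).codRestrict s.nagata fun f =>
    show _ ∈ s.nagata from ⟨f, 1, s.nagataSet.one_mem, by simp⟩).toAlgebra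

theorem coe_algebraMap_nagata (s : SemistarOp D K) (f : D[X]) :
    (algebraMap D[X] s.nagata f : RatFunc K) = polyToRat D K f := rfl

theorem algebraMap_nagata_injective (s : SemistarOp D K) :
    Function.Injective (algebraMap D[X] s.nagata) := by
  rw [injective_iff_map_eq_zero]
  intro f hf
  by_contra hf0
  exact polyToRat_ne_zero (K := K) hf0 (by rw [← coe_algebraMap_nagata, hf]; rfl)

instance (s : SemistarOp D K) : IsLocalization s.nagataSet s.nagata where
  map_units := by
    intro g
    have hg := polyToRat_ne_zero (K := K) g.2.1
    refine IsUnit.of_mul_eq_one ⟨(polyToRat D K g)⁻¹, 1, g, g.2, by simp⟩ (Subtype.ext ?_)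
    simp [coe_algebraMap_nagata, hg]
  surj := by
    rintro ⟨_, f, g, hg, rfl⟩
    refine ⟨(f, ⟨g, hg⟩), Subtype.ext ?_⟩
    simp [coe_algebraMap_nagata, polyToRat_ne_zero (K := K) hg.1]
  exists_of_eq := fun h => ⟨1, by rw [s.algebraMap_nagata_injective h]⟩

/-- The nonzero maximal ideals of the Nagata ring lie over the ideals `M[X]` with `M`
quasi-`⋆_f`-maximal. -/
theorem exists_isQuasiMaximal_comap_eq (s : SemistarOp D K) {P : Ideal s.nagata}
    (hP : P.IsMaximal) (hP0 : P ≠ ⊥) :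
    ∃ M, s.finType.IsQuasiMaximal M ∧ P.under D[X] = M.map C := by
  have hmap := IsLocalization.map_under s.nagataSet s.nagata P
  obtain ⟨M, hM, hle⟩ : ∃ M, s.finType.IsQuasiMaximal M ∧ P.under D[X] ≤ M.map C := by
    by_contra! hno
    obtain ⟨f, hfP, hf⟩ := s.exists_mem_nagataSet (J := P.under D[X]) (fun hbot => hP0 (by
      rw [← hmap, hbot, Ideal.map_bot])) hno
    exact Set.disjoint_left.1
      ((IsLocalization.disjoint_under_iff s.nagataSet s.nagata P).2 hP.ne_top) hf hfP
  have hMp : M.IsPrime := hM.isPrime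
  have hMC : (M.map C : Ideal D[X]).IsPrime := Ideal.isPrime_map_C_of_isPrime
  refine ⟨M, hM, ?_⟩
  have hpr := IsLocalization.isPrime_of_isPrime_disjoint s.nagataSet s.nagata _ hMC
    hM.disjoint_nagataSet
  have hPle : P ≤ (M.map C).map (algebraMap D[X] s.nagata) := hmap ▸ Ideal.map_mono hle
  rw [hP.eq_of_le hpr.ne_top hPle]
  exact IsLocalization.under_map_of_isPrime_disjoint s.nagataSet s.nagata hMC hM.disjoint_nagataSet

theorem IsQuasiMaximal.exists_isMaximal_nagata {s : SemistarOp D K} {M : Ideal D}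
    (hM : s.finType.IsQuasiMaximal M) :
    ∃ P : Ideal s.nagata, P.IsMaximal ∧ P ≠ ⊥ ∧ P.under D[X] = M.map C := by
  have hMp : M.IsPrime := hM.isPrime
  have hMC : (M.map C : Ideal D[X]).IsPrime := Ideal.isPrime_map_C_of_isPrime
  have hpr := IsLocalization.isPrime_of_isPrime_disjoint s.nagataSet s.nagata _ hMC
    hM.disjoint_nagataSet
  obtain ⟨P, hP, hle⟩ := Ideal.exists_le_maximal _ hpr.ne_top
  have hle' : M.map C ≤ P.under D[X] := Ideal.map_le_iff_le_comap.1 hle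
  have hP0 : P ≠ ⊥ := by
    rintro rfl
    obtain ⟨a, haM, ha0⟩ := Submodule.exists_mem_ne_zero_of_ne_bot hM.prop.1.1
    have : algebraMap D[X] s.nagata (C a) = 0 := hle' (Ideal.mem_map_of_mem C haM)
    rw [← map_zero (algebraMap D[X] s.nagata)] at this
    exact ha0 (C_eq_zero.1 (s.algebraMap_nagata_injective this))
  obtain ⟨M', hM', hPM'⟩ := s.exists_isQuasiMaximal_comap_eq hP hP0
  have hMM' : M ≤ M' := fun a ha => by
    have := hPM' ▸ hle' (Ideal.mem_map_of_mem C ha)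
    simpa using Ideal.mem_map_C_iff.1 this 0
  obtain rfl := hM.eq_of_le hM'.prop hMM'
  exact ⟨P, hP, hP0, hPM'⟩

end Nagata

/-! ### Discrete valuation rings under the passage from `D_M` to `D_M(X)` -/

section Transfer

variable [FaithfulSMul D K] {s : SemistarOp D K} {M : Ideal D} [M.IsPrime]
  {P : Ideal s.nagata} [P.IsPrime]

theorem isDiscreteValuationRing_nagata_atPrime (hPM : P.under D[X] = M.map C)
    [IsDiscreteValuationRing (Localization.AtPrime M)] :
    IsDiscreteValuationRing (Localization.AtPrime P) := by
  have hval := IsValuationAtPrime.of_isDiscreteValuationRing M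
  have hmem : ∀ f : D[X], algebraMap D[X] s.nagata f ∈ P ↔ f ∈ M.map C := fun f => by
    rw [← hPM]; rfl
  have hmemC : ∀ a : D, algebraMap D[X] s.nagata (C a) ∈ P ↔ a ∈ M := fun a => by
    rw [hmem, Ideal.mem_map_C_iff]
    refine ⟨fun h => by simpa using h 0, fun h n => ?_⟩
    rw [coeff_C]
    split_ifs
    exacts [h, zero_mem _]
  obtain ⟨π, hπ, hπ0, h⟩ := exists_uniformizer_of_isDiscreteValuationRing_atPrime M
  refine isDiscreteValuationRing_atPrime_of_forall ((hmemC π).2 hπ) ?_ ?_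
  · rw [Ne, ← map_zero (algebraMap D[X] s.nagata)]
    exact fun h => hπ0 (C_eq_zero.1 (s.algebraMap_nagata_injective h))
  · intro r hr
    obtain ⟨⟨f, g⟩, hfg⟩ := IsLocalization.surj s.nagataSet r
    have hgP : algebraMap D[X] s.nagata g ∉ P := fun hg =>
      Ideal.IsPrime.ne_top' (P.eq_top_of_isUnit_mem hg (IsLocalization.map_units _ g))
    have hf : f ≠ 0 := by
      rintro rfl
      rw [map_zero] at hfg
      exact hr ((IsLocalization.map_units s.nagata g).mul_left_eq_zero.1 hfg)
    obtain ⟨i, hi0, t, ht, f', hf', htf⟩ := hval.exists_coeff_mul hf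
    obtain ⟨n, u, hu, v, hv, huv⟩ := h _ hi0
    refine ⟨n, algebraMap D[X] s.nagata (C u) *
      (algebraMap D[X] s.nagata (C t) * algebraMap D[X] s.nagata g), fun hP => ?_,
      algebraMap D[X] s.nagata (C v * f'), fun hP => ?_, ?_⟩
    · rcases Ideal.IsPrime.mem_or_mem ‹_› hP with hP | hP
      · exact hu ((hmemC u).1 hP)
      · exact (Ideal.IsPrime.mem_or_mem ‹_› hP).elim (fun h => ht ((hmemC t).1 h)) hgP
    · rw [map_mul] at hP
      exact (Ideal.IsPrime.mem_or_mem ‹_› hP).elim (fun h => hv ((hmemC v).1 h))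
        fun h => hf' ((hmem f').1 h)
    · rw [mul_assoc, mul_assoc, mul_comm _ r, hfg, ← map_mul, ← map_mul, ← map_pow, ← map_mul,
        htf, ← mul_assoc, ← C_mul, huv, C_mul, C_pow, mul_right_comm]

/-- Some `m ∈ M` is a uniformizer at `P`, since `M` generates `P`. If `a ∈ D` is `m ^ n` up to a
unit `g / f` of the localization at `P`, then comparing coefficients in `f * a = g * m ^ n` turns this
into a relation over `D`. -/
theorem isDiscreteValuationRing_atPrime_of_nagata (hPM : P.under D[X] = M.map C)
    [IsDiscreteValuationRing (Localization.AtPrime P)] :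
    IsDiscreteValuationRing (Localization.AtPrime M) := by
  have hmem : ∀ f : D[X], algebraMap D[X] s.nagata f ∈ P ↔ f ∈ M.map C := fun f => by
    rw [← hPM]; rfl
  have hmap : M.map ((algebraMap D[X] s.nagata).comp C) = P := by
    rw [← Ideal.map_map, ← hPM]
    exact IsLocalization.map_under s.nagataSet s.nagata P
  obtain ⟨m, hm, hirr⟩ := exists_irreducible_algebraMap_of_map_eq P _ hmap
  have hm0 : m ≠ 0 := by
    rintro rfl
    exact hirr.ne_zero (by simp)
  refine isDiscreteValuationRing_atPrime_of_forall hm hm0 fun a ha => ?_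
  have ha' : algebraMap D[X] s.nagata (C a) ≠ 0 := by
    rw [Ne, ← map_zero (algebraMap D[X] s.nagata)]
    exact fun h => ha (C_eq_zero.1 (s.algebraMap_nagata_injective h))
  obtain ⟨n, u, hu, v, hv, huv⟩ := exists_mul_eq_mul_pow_of_irreducible hirr ha'
  obtain ⟨⟨⟨f, g⟩, d⟩, hd⟩ : ∃ p : (D[X] × D[X]) × s.nagataSet,
      u * algebraMap D[X] s.nagata p.2 = algebraMap D[X] s.nagata p.1.1 ∧
        v * algebraMap D[X] s.nagata p.2 = algebraMap D[X] s.nagata p.1.2 := by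
    obtain ⟨⟨f, d⟩, hf⟩ := IsLocalization.surj s.nagataSet u
    obtain ⟨⟨g, e⟩, hg⟩ := IsLocalization.surj s.nagataSet v
    refine ⟨⟨⟨f * e, g * d⟩, d * e⟩, ?_, ?_⟩
    · simp only [Submonoid.coe_mul, map_mul, ← hf]; ring
    · simp only [Submonoid.coe_mul, map_mul, ← hg]; ring
  have hdP : algebraMap D[X] s.nagata d ∉ P := fun hg =>
    Ideal.IsPrime.ne_top' (P.eq_top_of_isUnit_mem hg (IsLocalization.map_units _ d))
  have hfM : f ∉ M.map C := by
    rw [← hmem, ← hd.1]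
    exact fun h => (Ideal.IsPrime.mem_or_mem ‹_› h).elim hu hdP
  have hgM : g ∉ M.map C := by
    rw [← hmem, ← hd.2]
    exact fun h => (Ideal.IsPrime.mem_or_mem ‹_› h).elim hv hdP
  have hfg : f * C a = g * C (m ^ n) := by
    refine s.algebraMap_nagata_injective ?_
    rw [map_mul, map_mul, ← hd.1, ← hd.2, mul_right_comm, huv, C_pow, map_pow, RingHom.comp_apply]
    ring
  have hco : ∀ k, f.coeff k * a = g.coeff k * m ^ n := fun k => by
    have := congrArg (fun p => Polynomial.coeff p k) hfg
    simpa only [coeff_mul_C] using this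
  obtain ⟨i, hi⟩ : ∃ i, f.coeff i ∉ M := by
    by_contra! h; exact hfM (Ideal.mem_map_C_iff.2 h)
  obtain ⟨j, hj⟩ : ∃ j, g.coeff j ∉ M := by
    by_contra! h; exact hgM (Ideal.mem_map_C_iff.2 h)
  refine ⟨n, _, hi, _, fun hgi => ?_, hco i⟩
  -- `f_i ∉ M` and `g_j ∉ M` come from different indices; the common ratio `f_k / g_k` shows that
  -- `g_i ∉ M` as well.
  have : g.coeff j * f.coeff i = g.coeff i * f.coeff j := by
    refine mul_right_cancel₀ ha ?_
    rw [mul_assoc, hco i, mul_assoc, hco j]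
    ring
  exact (Ideal.IsPrime.mem_or_mem ‹M.IsPrime› (this ▸ M.mul_mem_right _ hgi)).elim hj hi

end Transfer

/-! ### The Kronecker function ring -/

section Kronecker

theorem div_mem_kronecker (s : SemistarOp D K) {p w : D[X]}
    (h : p.contentIdeal ≤ w.contentIdeal) : polyToRat D K p / polyToRat D K w ∈ s.kronecker := by
  by_cases hp : p = 0
  · exact .inr (by simp [hp])
  · refine .inl ⟨p, w, hp, ?_, rfl, 1, one_ne_zero, ?_⟩
    · rintro rfl
      rw [contentIdeal_zero, le_bot_iff, contentIdeal_eq_bot_iff] at h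
      exact hp h
    · rw [contentIdeal_one, Ideal.mul_top, Ideal.mul_top]
      exact s.star_mono _ _ (IsLocalization.coeSubmodule_mono K h)

variable [FaithfulSMul D K] {s : SemistarOp D K}

/-- If `D_M` is a valuation ring, then `(c(f)c(h))^⋆ ⊆ (c(g)c(h))^⋆` forces `f / g` into
`D[X]_{M[X]}`. Let `f_i`, `g_j`, `h_k` generate the contents over `D_M`. Then `f_i h_k ∈ (g_j h_k D)^⋆` up
to a factor outside `M`, so `h_k` cancels and `f_i / g_j ∈ D^⋆ ⊆ D_M`. -/
theorem IsQuasiMaximal.exists_mul_eq_mul_of_star_le {M : Ideal D}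
    (hM : s.finType.IsQuasiMaximal M) (hval : IsValuationAtPrime M) {f g h : D[X]}
    (hg : g ≠ 0) (hh : h ≠ 0)
    (hle : s.star (toSub K (f.contentIdeal * h.contentIdeal)) ≤
        s.star (toSub K (g.contentIdeal * h.contentIdeal))) :
    ∃ p ∉ M.map C, ∃ q : D[X], p * f = q * g := by
  have hMp : M.IsPrime := hM.isPrime
  have hMC : (M.map C : Ideal D[X]).IsPrime := Ideal.isPrime_map_C_of_isPrime
  have hCnot : ∀ {a : D}, a ∉ M → C a ∉ (M.map C : Ideal D[X]) := fun ha hC =>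
    ha (by simpa using Ideal.mem_map_C_iff.1 hC 0)
  by_cases hf : f = 0
  · exact ⟨1, fun h => hMC.ne_top ((Ideal.eq_top_iff_one _).2 h), 0, by simp [hf]⟩
  obtain ⟨i, -, t, ht, f', -, htf⟩ := hval.exists_coeff_mul hf
  obtain ⟨j, hj0, u, hu, g', hg', hug⟩ := hval.exists_coeff_mul hg
  obtain ⟨k, hk0, v, hv, h', -, hvh⟩ := hval.exists_coeff_mul hh
  have hj0' : algebraMap D K (g.coeff j) ≠ 0 := by rwa [Ne, FaithfulSMul.algebraMap_eq_zero_iff]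
  have hk0' : algebraMap D K (h.coeff k) ≠ 0 := by rwa [Ne, FaithfulSMul.algebraMap_eq_zero_iff]
  have hcont : ∀ {p p' : D[X]} {c d : D}, C c * p = C d * p' →
      p.contentIdeal ≤ Submodule.comap (LinearMap.mulLeft D c) (Ideal.span {d}) := by
    intro p p' c d hp
    rw [contentIdeal_def, Ideal.span_le]
    intro a ha
    obtain ⟨n, -, rfl⟩ := mem_coeffs_iff.1 (Finset.mem_coe.1 ha)
    have := congrArg (fun p => Polynomial.coeff p n) hp
    simp only [coeff_C_mul] at this
    exact Ideal.mem_span_singleton.2 ⟨_, this⟩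
  have hdvd : ∀ x ∈ g.contentIdeal * h.contentIdeal,
      g.coeff j * h.coeff k ∣ u * v * x := by
    intro x hx
    induction hx using Submodule.mul_induction_on' with
    | mem_mul_mem a ha b hb =>
      have h1 := Ideal.mem_span_singleton.1 (hcont hug ha)
      have h2 := Ideal.mem_span_singleton.1 (hcont hvh hb)
      have := mul_dvd_mul h1 h2
      simpa [mul_mul_mul_comm] using this
    | add a ha b hb h1 h2 => rw [mul_add]; exact dvd_add h1 h2
  -- With `r = u v / (g_j h_k)`: `r • c(g)c(h) ⊆ D`, so `r • (c(g)c(h))^⋆ ⊆ D^⋆`.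
  have hsub : (algebraMap D K (u * v) / algebraMap D K (g.coeff j * h.coeff k)) •
      toSub K (g.contentIdeal * h.contentIdeal) ≤ 1 := by
    intro y hy
    obtain ⟨z, hz, rfl⟩ := Submodule.mem_smul_pointwise_iff_exists _ _ _ |>.1 hy
    obtain ⟨x, hx, rfl⟩ := (IsLocalization.mem_coeSubmodule K _).1 hz
    obtain ⟨d, hd⟩ := hdvd x hx
    refine Submodule.mem_one.2 ⟨d, ?_⟩
    change _ = _ * algebraMap D K x
    rw [div_mul_eq_mul_div, ← map_mul, hd, map_mul,
      mul_div_cancel_left₀]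
    rw [map_mul]
    exact mul_ne_zero hj0' hk0'
  have hfh : algebraMap D K (f.coeff i * h.coeff k) ∈
      s.star (toSub K (g.contentIdeal * h.contentIdeal)) :=
    hle (s.le_star _ ((IsLocalization.mem_coeSubmodule K _).2
      ⟨_, Ideal.mul_mem_mul (f.coeff_mem_contentIdeal i) (h.coeff_mem_contentIdeal k), rfl⟩))
  have hstar := s.smul_star_le _ hsub (Submodule.smul_mem_pointwise_smul _
    (algebraMap D K (u * v) / algebraMap D K (g.coeff j * h.coeff k)) _ hfh)
  have heq : (algebraMap D K (u * v) / algebraMap D K (g.coeff j * h.coeff k)) •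
      algebraMap D K (f.coeff i * h.coeff k) =
        algebraMap D K (u * v * f.coeff i) / algebraMap D K (g.coeff j) := by
    simp only [smul_eq_mul, map_mul]
    field_simp
  rw [heq] at hstar
  obtain ⟨w, hw, c, hc⟩ := hM.exists_mul_eq_mul_of_div_mem_star_one hval hj0 hstar
  refine ⟨C (w * (u * v) * t) * g', fun hP => ?_, C (c * u) * f', ?_⟩
  · refine (hMC.mem_or_mem hP).elim (fun hP => hCnot ?_ hP) hg'
    have hm : ∀ {x y : D}, x ∉ M → y ∉ M → x * y ∉ M := fun hx hy hxy =>
      (hMp.mem_or_mem hxy).elim hx hy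
    exact hm (hm hw (hm hu hv)) ht
  · have hj0C : C (g.coeff j) ≠ 0 := C_ne_zero.2 hj0
    have hcC : C w * (C u * C v * C (f.coeff i)) = C c * C (g.coeff j) := by
      rw [← C_mul, ← C_mul, ← C_mul, ← C_mul, hc]
    refine mul_left_cancel₀ hj0C ?_
    simp only [C_mul]
    calc C (g.coeff j) * (C w * (C u * C v) * C t * g' * f)
        = (C w * (C u * C v)) * (C t * f) * (C (g.coeff j) * g') := by ring
      _ = (C w * (C u * C v * C (f.coeff i))) * f' * (C u * g) := by rw [htf, ← hug]; ring
      _ = C (g.coeff j) * (C c * C u * f' * g) := by rw [hcC]; ring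

theorem nagata_subset_kronecker (s : SemistarOp D K) :
    (s.nagata : Set (RatFunc K)) ⊆ s.kronecker := by
  rintro _ ⟨f, g, hg, rfl⟩
  by_cases hf : f = 0
  · exact .inr (by simp [hf])
  · refine .inl ⟨f, g, hf, hg.1, rfl, 1, one_ne_zero, ?_⟩
    rw [contentIdeal_one, Ideal.mul_top, Ideal.mul_top, hg.2]
    exact s.star_toSub_le _

theorem kronecker_subset_nagata
    (h : ∀ M, s.finType.IsQuasiMaximal M → IsValuationAtPrime M) :
    s.kronecker ⊆ (s.nagata : Set (RatFunc K)) := by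
  rintro _ (⟨f, g, hf, hg, rfl, k, hk, hle⟩ | rfl)
  -- The denominators `u` with `u * (f / g) ∈ D[X]` form an ideal.
  · set J : Ideal D[X] := Submodule.comap (LinearMap.mulLeft D[X] f) (Ideal.span {g})
    have hJ : J ≠ ⊥ := by
      intro hbot
      have : g ∈ J := Ideal.mem_span_singleton.2 ⟨f, mul_comm _ _⟩
      rw [hbot] at this
      exact hg this
    obtain ⟨u, hu, huN⟩ := s.exists_mem_nagataSet hJ fun M hM hJM => by
      obtain ⟨p, hp, q, hpq⟩ := hM.exists_mul_eq_mul_of_star_le (h M hM) hg hk hle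
      exact hp (hJM (Ideal.mem_span_singleton.2 ⟨q, by
        rw [LinearMap.mulLeft_apply, mul_comm, hpq, mul_comm]⟩))
    obtain ⟨v, hv⟩ := Ideal.mem_span_singleton.1 hu
    refine ⟨v, u, huN, ?_⟩
    rw [div_eq_div_iff (polyToRat_ne_zero hg) (polyToRat_ne_zero huN.1), ← map_mul, ← map_mul,
      mul_comm v]
    exact congrArg _ hv
  · exact s.nagata.zero_mem

/-- The ideal generated by `f` and `g` is generated by `f + X ^ k * g` for `k` large: the
quotients of `f` and `g` by it lie in the Kronecker function ring, by comparison of contents. -/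
theorem isBezout_nagata (h : (s.nagata : Set (RatFunc K)) = s.kronecker) : IsBezout s.nagata := by
  have hdvd : ∀ {p w d : D[X]} {x z : s.nagata}, p.contentIdeal ≤ w.contentIdeal →
      x * algebraMap D[X] s.nagata d = algebraMap D[X] s.nagata p → d ≠ 0 →
      z * algebraMap D[X] s.nagata d = algebraMap D[X] s.nagata w → z ∣ x := by
    intro p w d x z hle hx hd hz
    have hmem : polyToRat D K p / polyToRat D K w ∈ s.nagata := by
      have := s.div_mem_kronecker hle
      rwa [← h] at this
    have hd0 : algebraMap D[X] s.nagata d ≠ 0 := by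
      rw [Ne, ← map_zero (algebraMap D[X] s.nagata)]
      exact fun h => hd (s.algebraMap_nagata_injective h)
    refine ⟨⟨_, hmem⟩, mul_right_cancel₀ hd0 ?_⟩
    rw [mul_right_comm, hx, hz]
    refine Subtype.ext ?_
    rw [Subring.coe_mul, coe_algebraMap_nagata, coe_algebraMap_nagata]
    by_cases hw : w = 0
    · rw [hw, contentIdeal_zero, le_bot_iff, contentIdeal_eq_bot_iff] at hle
      simp [hle]
    · rw [mul_div_cancel₀ _ (polyToRat_ne_zero hw)]
  rw [IsBezout.iff_span_pair_isPrincipal]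
  intro x y
  obtain ⟨⟨f, d⟩, hf⟩ := IsLocalization.surj s.nagataSet x
  obtain ⟨⟨g, e⟩, hg⟩ := IsLocalization.surj s.nagataSet y
  obtain ⟨k, hk₁, hk₂⟩ := exists_contentIdeal_ge (f * (e : D[X])) (g * (d : D[X]))
  have hde : ((d * e : s.nagataSet) : D[X]) ≠ 0 := (d * e).2.1
  have hx : x * algebraMap D[X] s.nagata (d * e : s.nagataSet) =
      algebraMap D[X] s.nagata (f * e) := by
    simp only [Submonoid.coe_mul, map_mul, ← hf]; ring
  have hy : y * algebraMap D[X] s.nagata (d * e : s.nagataSet) =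
      algebraMap D[X] s.nagata (g * d) := by
    simp only [Submonoid.coe_mul, map_mul, ← hg]; ring
  set z : s.nagata := x + algebraMap D[X] s.nagata (X ^ k) * y with hzdef
  have hz : z * algebraMap D[X] s.nagata (d * e : s.nagataSet) =
      algebraMap D[X] s.nagata (f * (e : D[X]) + X ^ k * (g * (d : D[X]))) := by
    rw [hzdef, add_mul, mul_assoc, hx, hy, ← map_mul, ← map_add]
  refine ⟨z, le_antisymm ?_ ?_⟩
  · rw [Ideal.submodule_span_eq, Ideal.span_le, Set.insert_subset_iff, Set.singleton_subset_iff]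
    exact ⟨Ideal.mem_span_singleton.2 (hdvd hk₁ hx hde hz),
      Ideal.mem_span_singleton.2 (hdvd hk₂ hy hde hz)⟩
  · rw [Ideal.submodule_span_eq, Ideal.span_singleton_le_iff_mem, Ideal.mem_span_pair]
    exact ⟨1, algebraMap D[X] s.nagata (X ^ k), by rw [one_mul]⟩

end Kronecker

/-! ### The almost Dedekind property of the Nagata ring -/

theorem isAlmostDedekindDomain_nagata_iff [FaithfulSMul D K] (s : SemistarOp D K) :
    IsAlmostDedekindDomain s.nagata ↔ s.IsAlmostDedekind := by
  constructor
  · intro h M hM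
    have := hM.isPrime
    obtain ⟨P, hP, hP0, hPM⟩ := hM.exists_isMaximal_nagata
    have := h P hP0
    exact isDiscreteValuationRing_atPrime_of_nagata hPM
  · intro h P hP hP0
    obtain ⟨M, hM, hPM⟩ := s.exists_isQuasiMaximal_comap_eq hP hP0
    have := hM.isPrime
    have := h M hM
    exact isDiscreteValuationRing_nagata_atPrime hPM

theorem IsAlmostDedekind.nagata_eq_kronecker [FaithfulSMul D K] {s : SemistarOp D K}
    (h : s.IsAlmostDedekind) : (s.nagata : Set (RatFunc K)) = s.kronecker :=
  Set.Subset.antisymm s.nagata_subset_kronecker <| kronecker_subset_nagata fun M hM => by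
    have := hM.isPrime
    have := h M hM
    exact IsValuationAtPrime.of_isDiscreteValuationRing M

end SemistarOp

theorem theorem2p5 {D K : Type*} [CommRing D] [IsDomain D] [Field K] [Algebra D K]
    [IsFractionRing D K] (hD : ¬ IsField D) (s : SemistarOp D K) :
    List.TFAE [
      s.IsAlmostDedekind,
      IsAlmostDedekindDomain s.nagata,
      IsField s.nagata ∨
        (ringKrullDim s.nagata = 1 ∧ IsPruferDomain s.nagata ∧
          ∀ M : Ideal s.nagata, M.IsMaximal → ¬ IsIdempotentElem M),
      (s.nagata : Set (RatFunc K)) = s.kronecker ∧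
        IsAlmostDedekindDomain s.nagata ∧ IsBezout s.nagata] := by
  tfae_have 2 ↔ 1 := s.isAlmostDedekindDomain_nagata_iff
  tfae_have 1 → 4 := fun h => ⟨h.nagata_eq_kronecker, s.isAlmostDedekindDomain_nagata_iff.2 h,
    SemistarOp.isBezout_nagata h.nagata_eq_kronecker⟩
  tfae_have 4 → 3 := by
    rintro ⟨-, h, hB⟩
    refine or_iff_not_imp_left.2 fun hF => ⟨h.ringKrullDim_eq_one hF, .of_isBezout, fun M hM => ?_⟩
    exact h.not_isIdempotentElem hF hM
  tfae_have 3 → 2 := by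
    rintro (hF | ⟨hdim, hPr, hid⟩)
    · intro M hM hM0
      let := hF.toField
      exact (hM0 (Ideal.eq_bot_of_prime M)).elim
    · exact hPr.isAlmostDedekindDomain hdim.le hid
  tfae_finish
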